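/- Let $\Gamma$ be a countable group and let $X_n = x\xi_1\xi_2\cdots\xi_n$ be a random walk on $\Gamma$, where the steps $\xi_i$ are independent with common law $\mu$ (not necessarily of finite support). Write $p^n(x,y)=P^x\{X_n=y\}$ and $p(x,y)=p^1(x,y)=\mu(x^{-1}y)$. Assume that the walk is symmetric ($\mu(g^{-1})=\mu(g)$ for all $g\in\Gamma$), irreducible (the semigroup generated by the support of $\mu$ is $\Gamma$) and aperiodic (the greatest common divisor of $\{n\ge 1 : p^n(1,1)>0\}$ is $1$). Then the radius of convergence $R$ of the Green's function $G_z(x,y)=\sum_{n\ge 0}p^n(x,y)z^n$ is positive, finite and the same for all $x,y\in\Gamma$, and there exists $\varepsilon>0$ such that the spectrum of the Markov operator $\mathbb{P}$ on the complex Hilbert space $\ell^2(\Gamma)$, $\mathbb{P}u(x)=\sum_{y\in\Gamma} p(x,y)u(y)$, is contained in the real interval $[-R^{-1}(1+\varepsilon)^{-1},R^{-1}]$. Consequently, with the same $\varepsilon$, for all $x,y\in\Gamma$ the Green's function $z\mapsto G_z(x,y)$ on $\{|z|<R\}$ extends holomorphically to the doubly slit plane $\mathbb{C}\setminus\big((-\infty,-R(1+\varepsilon)]\cup[R,\infty)\big)$.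 -/

import Mathlib

open scoped ENNReal

namespace RandomWalk

/-- The law of `X_n = x * ξ_1 * ⋯ * ξ_n`, where the steps `ξ_i` are independent with law `μ`,
i.e. the time-`n` law under `P^x` of the right random walk with step distribution `μ`. -/
noncomputable def law {Γ : Type*} [Group Γ] (μ : PMF Γ) (x : Γ) : ℕ → PMF Γ
  | 0 => PMF.pure x
  | n + 1 => (law μ x n).bind fun z => μ.map fun g => z * g

/-- The `n`-step transition probability `p^n(x, y) = P^x{X_n = y}`. -/
noncomputable def transProb {Γ : Type*} [Group Γ] (μ : PMF Γ) (n : ℕ) (x y : Γ) : ℝ :=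
  (law μ x n y).toReal

/-- The step distribution is invariant under inversion. -/
def IsSymmetric {Γ : Type*} [Group Γ] (μ : PMF Γ) : Prop :=
  ∀ g : Γ, μ g⁻¹ = μ g

/-- The semigroup generated by the support of the step distribution is the whole group. -/
def IsIrreducible {Γ : Type*} [Group Γ] (μ : PMF Γ) : Prop :=
  Subsemigroup.closure μ.support = ⊤

/-- The greatest common divisor of the return times `{n ≥ 1 : p^n(1, 1) > 0}` is `1`: the only
natural number dividing all of them is `1`. -/
def IsAperiodic {Γ : Type*} [Group Γ] (μ : PMF Γ) : Prop :=
  ∀ d : ℕ, (∀ n : ℕ, 1 ≤ n → 0 < transProb μ n 1 1 → d ∣ n) → d = 1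

/-- The radius of convergence of the Green's function `G_z(x, y) = ∑ p^n(x, y) z^n`. -/
noncomputable def greenRadius {Γ : Type*} [Group Γ] (μ : PMF Γ) (x y : Γ) : ℝ≥0∞ :=
  (FormalMultilinearSeries.ofScalars ℂ fun n : ℕ => (transProb μ n x y : ℂ)).radius

/-- The Hilbert space `ℓ²(Γ)` of complex-valued square-summable functions. -/
abbrev EllTwo (Γ : Type*) : Type _ := lp (fun _ : Γ => ℂ) 2

theorem transProb_one {Γ : Type*} [Group Γ] (μ : PMF Γ) (x y : Γ) :
    transProb μ 1 x y = (μ (x⁻¹ * y)).toReal := by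
  classical
  unfold transProb law law
  rw [PMF.pure_bind, PMF.map_apply, tsum_eq_single (x⁻¹ * y)]
  · simp
  · intro g hg
    rw [if_neg]
    rintro rfl
    simp at hg

theorem summable_step {Γ : Type*} (μ : PMF Γ) : Summable fun g => (μ g).toReal :=
  ENNReal.summable_toReal μ.tsum_coe_ne_top

/-- Right translation `u ↦ u(· * g)`, an isometry of `ℓ²(Γ)`. -/
noncomputable def translate {Γ : Type*} [Group Γ] (g : Γ) : EllTwo Γ →ₗᵢ[ℂ] EllTwo Γ where
  toFun u := ⟨fun x => u (x * g), by
    have h := (memℓp_gen_iff (by norm_num)).1 (lp.memℓp u)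
    exact (memℓp_gen_iff (by norm_num)).2 ((Equiv.mulRight g).summable_iff.2 h)⟩
  map_add' u v := rfl
  map_smul' c u := rfl
  norm_map' u := by
    rw [lp.norm_eq_tsum_rpow (by norm_num), lp.norm_eq_tsum_rpow (by norm_num)]
    congr 1
    exact (Equiv.mulRight g).tsum_eq fun x => ‖u x‖ ^ (2 : ℝ≥0∞).toReal

/-- An auxiliary bounded operator with the values prescribed for the Markov operator. -/
theorem exists_markov {Γ : Type*} [Group Γ] (μ : PMF Γ) :
    ∃ T : EllTwo Γ →L[ℂ] EllTwo Γ, ∀ (u : EllTwo Γ) (x : Γ),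
      T u x = ∑' y : Γ, (transProb μ 1 x y : ℂ) * u y := by
  let t : Γ → (EllTwo Γ →L[ℂ] EllTwo Γ) := fun g =>
    ((μ g).toReal : ℂ) • (translate g).toContinuousLinearMap
  have ht : Summable t := by
    refine Summable.of_norm_bounded (summable_step μ) fun g => ?_
    refine (norm_smul_le ((μ g).toReal : ℂ) (translate g).toContinuousLinearMap).trans ?_
    have h1 : ‖(translate g).toContinuousLinearMap‖ ≤ 1 :=
      LinearIsometry.norm_toContinuousLinearMap_le _
    have h2 : ‖((μ g).toReal : ℂ)‖ = (μ g).toReal := by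
      simp
    rw [h2]
    exact mul_le_of_le_one_right ENNReal.toReal_nonneg h1
  refine ⟨∑' g, t g, fun u x => ?_⟩
  have h1 : HasSum (fun g => t g u) ((∑' g, t g) u) :=
    ht.hasSum.mapL (ContinuousLinearMap.apply ℂ (EllTwo Γ) u)
  have h2 : HasSum (fun g => t g u x) ((∑' g, t g) u x) :=
    h1.mapL (lp.evalCLM ℂ (fun _ : Γ => ℂ) 2 x)
  rw [← h2.tsum_eq, ← (Equiv.mulLeft x).tsum_eq fun y : Γ => (transProb μ 1 x y : ℂ) * u y]
  refine tsum_congr fun g => ?_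
  rw [Equiv.coe_mulLeft, transProb_one, inv_mul_cancel_left]
  rfl

/-- The Markov operator `(ℙ u)(x) = ∑_y p(x, y) u(y)`, as a bounded operator on `ℓ²(Γ)`. -/
noncomputable def markovOperator {Γ : Type*} [Group Γ] (μ : PMF Γ) :
    EllTwo Γ →L[ℂ] EllTwo Γ where
  toFun u := ⟨fun x => ∑' y : Γ, (transProb μ 1 x y : ℂ) * u y, by
    obtain ⟨T, hT⟩ := exists_markov μ
    rw [← funext (hT u)]
    exact lp.memℓp (T u)⟩
  map_add' u v := by
    obtain ⟨T, hT⟩ := exists_markov μ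
    ext x
    have h : T (u + v) x = T u x + T v x := by rw [map_add]; rfl
    rw [hT, hT, hT] at h
    exact h
  map_smul' c u := by
    obtain ⟨T, hT⟩ := exists_markov μ
    ext x
    have h : T (c • u) x = c • T u x := by rw [map_smul]; rfl
    rw [hT, hT] at h
    exact h
  cont := by
    obtain ⟨T, hT⟩ := exists_markov μ
    refine T.continuous.congr fun u => ?_
    ext x
    exact hT u x

end RandomWalk

/-! Everything rests on the identity ‖ℙ‖ = 1/R. The matrix entries of ℙ^n are the p^n(x, y), so p^n
≤ ‖ℙ‖^n. Conversely, a bound p^n(x, y) ≤ C r^n for one pair spreads to all pairs by irreducibility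
and so bounds the growth of ‖ℙ^n u‖ for finitely supported u; as ℙ is self-adjoint, n ↦ ‖ℙ^n u‖ is
log-convex, which forces ‖ℙ u‖ ≤ r‖u‖ (`norm_markovOperator_le_of_transProb_le`).

For the gap at the bottom, aperiodicity gives an odd n with a = p^n(1, 1) > 0. The kernel of ℙ^n - a
is nonnegative, so comparing u with |u| yields ⟨ℙ^n u, u⟩ ≥ (2a - ‖ℙ‖^n)‖u‖² (`le_re_inner_pow`).
Hence every spectral value l satisfies l^n ≥ 2a - ‖ℙ‖^n > -‖ℙ‖^n, and since n is odd, l stays away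
from -‖ℙ‖. The entries of (1 - zℙ)⁻¹ then continue the Green's function. -/

namespace RandomWalk

/-! ### Symmetric operators on a Hilbert space -/

section HilbertSpace

open ContinuousLinearMap
open scoped InnerProductSpace

variable {E : Type*} [NormedAddCommGroup E] [InnerProductSpace ℂ E]

/-- A quadratic lower bound for an operator is a lower bound for the real points of its spectrum. -/
theorem le_of_mem_spectrum_of_le_inner [CompleteSpace E] {T : E →L[ℂ] E} {c : ℝ}
    (h : ∀ u, c * ‖u‖ ^ 2 ≤ (⟪T u, u⟫_ℂ).re) {t : ℝ} (ht : (t : ℂ) ∈ spectrum ℂ T) : c ≤ t := by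
  by_contra! hlt
  refine ht ?_
  have hunit : IsUnit (T - algebraMap ℂ (E →L[ℂ] E) t) := by
    -- Lax–Milgram: for t < c the form of T - t is coercive with constant c - t.
    refine isUnit_of_forall_le_norm_inner_map _ (c := ⟨c - t, by linarith⟩)
      (NNReal.coe_pos.1 (sub_pos.2 hlt)) fun u => ?_
    refine le_trans ?_ (Complex.re_le_norm _)
    have h1 : (⟪(T - algebraMap ℂ (E →L[ℂ] E) t) u, u⟫_ℂ).re
        = (⟪T u, u⟫_ℂ).re - t * ‖u‖ ^ 2 := by
      rw [sub_apply, ContinuousLinearMap.algebraMap_apply, inner_sub_left, inner_smul_left,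
        Complex.conj_ofReal, Complex.sub_re, Complex.re_ofReal_mul]
      exact congrArg (_ - t * ·) (norm_sq_eq_re_inner (𝕜 := ℂ) u).symm
    rw [h1]
    change ‖u‖ ^ 2 * (c - t) ≤ _
    linarith [h u]
  rw [← neg_sub, IsUnit.neg_iff] at *
  exact hunit

/-- If the orbit of `u` under a symmetric operator grows at most like `s ^ n`, then already the
first step is bounded by `s`. -/
theorem norm_apply_le_of_norm_pow_apply_sq_le {T : E →L[ℂ] E} (hT : T.IsSymmetric) {u : E}
    {s C : ℝ} (hs : 0 < s) (h : ∀ n, ‖(T ^ n) u‖ ^ 2 ≤ C * (s ^ n) ^ 2) : ‖T u‖ ≤ s * ‖u‖ := by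
  have hsucc : ∀ n, (T ^ (n + 1)) u = T ((T ^ n) u) := fun n => by
    rw [pow_succ']; rfl
  -- Log-convexity of the orbit norms, from symmetry and Cauchy–Schwarz. Successive ratios therefore
  -- never drop below the first one; `hratio` says so without dividing.
  have hconv : ∀ n, ‖(T ^ (n + 1)) u‖ ^ 2 ≤ ‖(T ^ n) u‖ * ‖(T ^ (n + 2)) u‖ := fun n => by
    have h1 : ⟪(T ^ (n + 1)) u, (T ^ (n + 1)) u⟫_ℂ = ⟪(T ^ n) u, (T ^ (n + 2)) u⟫_ℂ := by
      rw [hsucc (n + 1)]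
      nth_rw 1 [hsucc n]
      exact hT _ _
    have h2 := norm_inner_le_norm (𝕜 := ℂ) ((T ^ n) u) ((T ^ (n + 2)) u)
    rw [← h1, inner_self_eq_norm_sq_to_K] at h2
    simpa using h2
  have hratio : ∀ n, ‖T u‖ * ‖(T ^ n) u‖ ≤ ‖u‖ * ‖(T ^ (n + 1)) u‖ := by
    intro n
    induction n with
    | zero => simp [mul_comm]
    | succ n ih =>
      rcases (norm_nonneg ((T ^ (n + 1)) u)).eq_or_lt with h0 | h0
      · rw [← h0, mul_zero]; positivity
      · refine le_of_mul_le_mul_right ?_ h0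
        calc ‖T u‖ * ‖(T ^ (n + 1)) u‖ * ‖(T ^ (n + 1)) u‖
            = ‖T u‖ * ‖(T ^ (n + 1)) u‖ ^ 2 := by ring
          _ ≤ ‖T u‖ * (‖(T ^ n) u‖ * ‖(T ^ (n + 2)) u‖) := by gcongr; exact hconv n
          _ = ‖T u‖ * ‖(T ^ n) u‖ * ‖(T ^ (n + 2)) u‖ := by ring
          _ ≤ ‖u‖ * ‖(T ^ (n + 1)) u‖ * ‖(T ^ (n + 2)) u‖ := by gcongr
          _ = ‖u‖ * ‖(T ^ (n + 1 + 1)) u‖ * ‖(T ^ (n + 1)) u‖ := by ring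
  have hpow : ∀ n, ‖T u‖ ^ n * ‖u‖ ≤ ‖u‖ ^ n * ‖(T ^ n) u‖ := by
    intro n
    induction n with
    | zero => simp
    | succ n ih =>
      calc ‖T u‖ ^ (n + 1) * ‖u‖ = ‖T u‖ * (‖T u‖ ^ n * ‖u‖) := by ring
        _ ≤ ‖T u‖ * (‖u‖ ^ n * ‖(T ^ n) u‖) := by gcongr
        _ = ‖u‖ ^ n * (‖T u‖ * ‖(T ^ n) u‖) := by ring
        _ ≤ ‖u‖ ^ n * (‖u‖ * ‖(T ^ (n + 1)) u‖) := 
          mul_le_mul_of_nonneg_left (hratio n) (by positivity)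
        _ = ‖u‖ ^ (n + 1) * ‖(T ^ (n + 1)) u‖ := by ring
  rcases (norm_nonneg u).eq_or_lt with h0 | h0
  · rw [norm_eq_zero.1 h0.symm]; simp
  by_contra! hlt
  -- Otherwise the orbit would outgrow s ^ n geometrically.
  have hq : 1 < (‖T u‖ / (s * ‖u‖)) ^ 2 :=
    one_lt_pow₀ ((one_lt_div (by positivity)).2 hlt) two_ne_zero
  obtain ⟨n, hn⟩ := pow_unbounded_of_one_lt (C / ‖u‖ ^ 2) hq
  refine hn.not_ge ?_
  rw [← pow_mul, mul_comm 2 n, pow_mul, div_pow, mul_pow, div_pow,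
    div_le_div_iff₀ (by positivity) (by positivity)]
  calc (‖T u‖ ^ n) ^ 2 * ‖u‖ ^ 2 = (‖T u‖ ^ n * ‖u‖) ^ 2 := by ring
    _ ≤ (‖u‖ ^ n * ‖(T ^ n) u‖) ^ 2 := 
        pow_le_pow_left₀ (by positivity) (hpow n) 2
    _ = (‖u‖ ^ n) ^ 2 * ‖(T ^ n) u‖ ^ 2 := by ring
    _ ≤ (‖u‖ ^ n) ^ 2 * (C * (s ^ n) ^ 2) := by gcongr; exact h n
    _ = C * (s ^ n * ‖u‖ ^ n) ^ 2 := by ring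

end HilbertSpace

/-! ### Transition probabilities -/

section TransitionProbabilities

variable {Γ : Type*} [Group Γ] (μ : PMF Γ)

theorem law_add (m n : ℕ) (x : Γ) :
    law μ x (m + n) = (law μ x m).bind fun z => law μ z n := by
  induction n with
  | zero => exact (PMF.bind_pure _).symm
  | succ n ih =>
    change (law μ x (m + n)).bind _ = (law μ x m).bind fun z => (law μ z n).bind _
    rw [ih, PMF.bind_bind]

theorem law_mul_left (g x : Γ) (n : ℕ) : law μ (g * x) n = (law μ x n).map (g * ·) := by
  induction n with
  | zero => exact (PMF.pure_map _ _).symm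
  | succ n ih =>
    simp only [law, ih, PMF.map_bind, PMF.bind_map, PMF.map_comp, Function.comp_def, mul_assoc]

theorem transProb_nonneg (n : ℕ) (x y : Γ) : 0 ≤ transProb μ n x y :=
  ENNReal.toReal_nonneg

theorem transProb_self (n : ℕ) (x : Γ) : transProb μ n x x = transProb μ n 1 1 := by
  classical
  unfold transProb
  congr 1
  conv_lhs =>
    rw [← mul_one x, law_mul_left, PMF.map_apply, tsum_eq_single 1 (by simp +contextual)]
  simp

/-- The Chapman–Kolmogorov equation. -/
theorem transProb_add (m n : ℕ) (x y : Γ) :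
    transProb μ (m + n) x y = ∑' z, transProb μ m x z * transProb μ n z y := by
  simp only [transProb, law_add μ m n, PMF.bind_apply, ← ENNReal.toReal_mul]
  exact ENNReal.tsum_toReal_eq fun z =>
    ENNReal.mul_ne_top (PMF.apply_ne_top _ _) (PMF.apply_ne_top _ _)

theorem transProb_mul_le (m n : ℕ) (x z y : Γ) :
    transProb μ m x z * transProb μ n z y ≤ transProb μ (m + n) x y := by
  rw [transProb, transProb, ← ENNReal.toReal_mul]
  refine ENNReal.toReal_mono (PMF.apply_ne_top _ _) ?_
  rw [law_add, PMF.bind_apply]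
  exact ENNReal.le_tsum (f := fun z => law μ x m z * law μ z n y) z

variable {μ}

theorem IsSymmetric.transProb_one_comm (h : IsSymmetric μ) (x y : Γ) :
    transProb μ 1 x y = transProb μ 1 y x := by
  rw [transProb_one, transProb_one, ← h, mul_inv_rev, inv_inv]

theorem IsIrreducible.exists_transProb_pos (h : IsIrreducible μ) (x y : Γ) :
    ∃ n, 0 < transProb μ n x y := by
  have key : ∀ g ∈ Subsemigroup.closure μ.support, ∀ x, ∃ n, 0 < transProb μ n x (x * g) := by
    intro g hg
    induction hg using Subsemigroup.closure_induction with
    | mem g hg =>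
      refine fun x => ⟨1, ?_⟩
      rw [transProb_one, inv_mul_cancel_left]
      exact ENNReal.toReal_pos ((PMF.mem_support_iff _ _).1 hg) (PMF.apply_ne_top _ _)
    | mul a b _ _ ha hb =>
      intro x
      obtain ⟨m, hm⟩ := ha x
      obtain ⟨n, hn⟩ := hb (x * a)
      rw [mul_assoc] at hn
      exact ⟨m + n, (mul_pos hm hn).trans_le (transProb_mul_le μ m n x (x * a) (x * (a * b)))⟩
  obtain ⟨n, hn⟩ := key (x⁻¹ * y) (h ▸ Subsemigroup.mem_top _) x
  exact ⟨n, by rwa [mul_inv_cancel_left] at hn⟩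

theorem IsAperiodic.exists_odd (h : IsAperiodic μ) : ∃ n, Odd n ∧ 0 < transProb μ n 1 1 := by
  by_contra! hno
  refine absurd (h 2 fun n _ hn => ?_) (by norm_num)
  by_contra hodd
  exact (hno n (Nat.not_even_iff_odd.1 fun he => hodd he.two_dvd)).not_gt hn

/-- By irreducibility, an exponential bound for one pair of points gives one for every pair. -/
theorem IsIrreducible.exists_transProb_le (h : IsIrreducible μ) {x y : Γ} {s C : ℝ}
    (hC : ∀ n, transProb μ n x y ≤ C * s ^ n) (a b : Γ) :
    ∃ D, ∀ n, transProb μ n a b ≤ D * s ^ n := by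
  obtain ⟨k, hk⟩ := h.exists_transProb_pos x a
  obtain ⟨l, hl⟩ := h.exists_transProb_pos b y
  -- Any path from a to b extends to one from x to y by k fixed steps before and l after.
  refine ⟨C * s ^ (k + l) / (transProb μ k x a * transProb μ l b y), fun n => ?_⟩
  rw [div_mul_eq_mul_div, le_div_iff₀ (by positivity)]
  calc transProb μ n a b * (transProb μ k x a * transProb μ l b y)
      = transProb μ k x a * transProb μ n a b * transProb μ l b y := by ring
    _ ≤ transProb μ (k + n) x b * transProb μ l b y := by gcongr; exact transProb_mul_le μ k n x a b
    _ ≤ transProb μ (k + n + l) x y := transProb_mul_le μ _ _ _ _ _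
    _ ≤ C * s ^ (k + n + l) := hC _
    _ = C * s ^ (k + l) * s ^ n := by ring

end TransitionProbabilities
-- Norm and spectrum of the Markov operator
section MarkovOperator

open scoped InnerProductSpace Topology
open Filter

variable {Γ : Type*}

/-- The truncation of a function to a finite set, as an element of `ℓ²(Γ)`. -/
noncomputable def truncate (s : Finset Γ) (f : Γ → ℂ) : EllTwo Γ :=
  open Classical in ∑ x ∈ s, lp.single 2 x (f x)

theorem tendsto_truncate (u : EllTwo Γ) : Tendsto (fun s => truncate s u) atTop (𝓝 u) := by
  classical
  have h := lp.hasSum_single (p := 2) (by norm_num) u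
  simpa only [HasSum, truncate, SummationFilter.unconditional_filter] using! h

theorem norm_truncate_sq (s : Finset Γ) (f : Γ → ℂ) :
    ‖truncate s f‖ ^ 2 = ∑ x ∈ s, ‖f x‖ ^ 2 := by
  classical
  have h := lp.norm_sum_single (E := fun _ : Γ => ℂ) (p := 2) (by norm_num) f s
  simpa [truncate] using! h

theorem hasSum_apply_apply {ι : Type*} {f : ι → EllTwo Γ →L[ℂ] EllTwo Γ}
    {T : EllTwo Γ →L[ℂ] EllTwo Γ} (h : HasSum f T) (u : EllTwo Γ) (x : Γ) :
    HasSum (fun i => f i u x) (T u x) :=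
  (h.mapL (ContinuousLinearMap.apply ℂ (EllTwo Γ) u)).mapL (lp.evalCLM ℂ (fun _ : Γ => ℂ) 2 x)

variable [Group Γ] {μ : PMF Γ}

theorem markovOperator_apply (u : EllTwo Γ) (x : Γ) :
    markovOperator μ u x = ∑' y, (transProb μ 1 x y : ℂ) * u y :=
  rfl

theorem markovOperator_pow_single [DecidableEq Γ] (n : ℕ) (y : Γ) (c : ℂ) (x : Γ) :
    (markovOperator μ ^ n) (lp.single 2 y c) x = transProb μ n x y * c := by
  induction n generalizing x with
  | zero =>
    rw [pow_zero, one_apply_eq_self, lp.single_apply]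
    rcases eq_or_ne x y with rfl | h
    · simp [transProb, law]
    · simp [transProb, law, h, h.symm]
  | succ n ih =>
    rw [pow_succ', mul_apply_eq_comp, markovOperator_apply, add_comm n, transProb_add,
      Complex.ofReal_tsum, ← tsum_mul_right]
    refine tsum_congr fun z => ?_
    rw [ih, Complex.ofReal_mul, mul_assoc]

theorem IsSymmetric.isSelfAdjoint_markovOperator (h : IsSymmetric μ) :
    IsSelfAdjoint (markovOperator μ) := by
  classical
  rw [ContinuousLinearMap.isSelfAdjoint_iff']
  ext u x
  have h1 := lp.inner_single_left (𝕜 := ℂ) x (1 : ℂ)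
    (ContinuousLinearMap.adjoint (markovOperator μ) u)
  rw [ContinuousLinearMap.adjoint_inner_right, lp.inner_eq_tsum] at h1
  have h2 : ∀ y, markovOperator μ (lp.single 2 x 1) y = transProb μ 1 x y := fun y => by
    have := markovOperator_pow_single (μ := μ) 1 x 1 y
    rwa [pow_one, mul_one, h.transProb_one_comm] at this
  simp only [h2, RCLike.inner_apply, Complex.conj_ofReal, map_one, mul_one] at h1
  rw [← h1, markovOperator_apply]
  exact tsum_congr fun y => mul_comm _ _

theorem transProb_le_norm_pow (n : ℕ) (x y : Γ) : transProb μ n x y ≤ ‖markovOperator μ‖ ^ n := by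
  classical
  calc transProb μ n x y = ‖(markovOperator μ ^ n) (lp.single 2 y (1 : ℂ)) x‖ := by
        rw [markovOperator_pow_single, mul_one, Complex.norm_real,
          Real.norm_of_nonneg (transProb_nonneg μ n x y)]
    _ ≤ ‖(markovOperator μ ^ n) (lp.single 2 y (1 : ℂ))‖ := lp.norm_apply_le_norm two_ne_zero _ _
    _ ≤ ‖markovOperator μ ^ n‖ * ‖lp.single (E := fun _ : Γ => ℂ) 2 y (1 : ℂ)‖ :=
        ContinuousLinearMap.le_opNorm _ _
    _ ≤ ‖markovOperator μ‖ ^ n := by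
        rw [lp.norm_single (by norm_num), norm_one, mul_one]
        -- The power 0 is separate because ‖1‖ ≤ ‖ℙ‖ ^ 0 is not an instance of submultiplicativity.
        rcases n.eq_zero_or_pos with rfl | hn
        · rw [pow_zero, pow_zero]
          exact ContinuousLinearMap.norm_id_le
        · exact norm_pow_le' _ hn

theorem norm_markovOperator_pos (μ : PMF Γ) : 0 < ‖markovOperator μ‖ := by
  obtain ⟨g, hg⟩ := μ.support_nonempty
  have h := transProb_le_norm_pow (μ := μ) 1 1 g
  rw [transProb_one, inv_one, one_mul, pow_one] at h
  exact (ENNReal.toReal_pos ((PMF.mem_support_iff _ _).1 hg) (PMF.apply_ne_top _ _)).trans_le h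

theorem re_inner_pow_truncate (n : ℕ) (s : Finset Γ) (f : Γ → ℂ) :
    (⟪(markovOperator μ ^ n) (truncate s f), truncate s f⟫_ℂ).re =
      ∑ y ∈ s, ∑ x ∈ s, transProb μ n x y * (⟪f y, f x⟫_ℂ).re := by
  classical
  simp only [truncate, map_sum, inner_sum, sum_inner, lp.inner_single_right,
    markovOperator_pow_single, Complex.re_sum]
  rw [Finset.sum_comm]
  refine Finset.sum_congr rfl fun y _ => Finset.sum_congr rfl fun x _ => ?_
  simp only [RCLike.inner_apply, map_mul, Complex.conj_ofReal]
  rw [mul_left_comm, Complex.re_ofReal_mul]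

theorem norm_markovOperator_le_of_transProb_le (hsymm : IsSymmetric μ) (hirr : IsIrreducible μ)
    {x y : Γ} {r C : ℝ} (hr : 0 < r) (hC : ∀ n, transProb μ n x y ≤ C * r ^ n) :
    ‖markovOperator μ‖ ≤ r := by
  choose D hD using hirr.exists_transProb_le hC
  have hsa := hsymm.isSelfAdjoint_markovOperator
  have hfin : ∀ (s : Finset Γ) (f : Γ → ℂ),
      ‖markovOperator μ (truncate s f)‖ ≤ r * ‖truncate s f‖ := by
    intro s f
    -- The constant comes from expanding ‖ℙ^n u‖² = ⟨ℙ^(2n) u, u⟩ over the finite support of u.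
    refine norm_apply_le_of_norm_pow_apply_sq_le hsa.isSymmetric hr
      (C := ∑ b ∈ s, ∑ a ∈ s, D a b * (‖f b‖ * ‖f a‖)) fun n => ?_
    have h1 : ‖(markovOperator μ ^ n) (truncate s f)‖ ^ 2 =
        (⟪(markovOperator μ ^ (n + n)) (truncate s f), truncate s f⟫_ℂ).re := by
      have h2 := (hsa.pow n).isSymmetric ((markovOperator μ ^ n) (truncate s f)) (truncate s f)
      rw [pow_add, mul_apply_eq_comp]
      refine Eq.trans ?_ (congrArg Complex.re h2).symm
      exact norm_sq_eq_re_inner (𝕜 := ℂ) _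
    rw [h1, re_inner_pow_truncate, Finset.sum_mul]
    refine Finset.sum_le_sum fun b _ => ?_
    rw [Finset.sum_mul]
    refine Finset.sum_le_sum fun a _ => ?_
    calc transProb μ (n + n) a b * (⟪f b, f a⟫_ℂ).re
        ≤ transProb μ (n + n) a b * (‖f b‖ * ‖f a‖) :=
          mul_le_mul_of_nonneg_left ((Complex.re_le_norm _).trans (norm_inner_le_norm _ _))
            (transProb_nonneg _ _ _ _)
      _ ≤ D a b * r ^ (n + n) * (‖f b‖ * ‖f a‖) := by gcongr; exact hD a b _
      _ = D a b * (‖f b‖ * ‖f a‖) * (r ^ n) ^ 2 := by ring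
  refine ContinuousLinearMap.opNorm_le_bound _ hr.le fun u => ?_
  exact le_of_tendsto_of_tendsto
    (((markovOperator μ).continuous.tendsto u).comp (tendsto_truncate u)).norm
    ((tendsto_truncate u).norm.const_mul r) (Eventually.of_forall fun s => hfin s u)

/-- Splitting off the diagonal of the kernel of `ℙ ^ n` and comparing `u` with `|u|` bounds the
quadratic form of `ℙ ^ n` from below. -/
theorem le_re_inner_pow (n : ℕ) (u : EllTwo Γ) :
    (2 * transProb μ n 1 1 - ‖markovOperator μ‖ ^ n) * ‖u‖ ^ 2 ≤
      (⟪(markovOperator μ ^ n) u, u⟫_ℂ).re := by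
  classical
  have hfin : ∀ (s : Finset Γ) (f : Γ → ℂ),
      (2 * transProb μ n 1 1 - ‖markovOperator μ‖ ^ n) * ‖truncate s f‖ ^ 2 ≤
        (⟪(markovOperator μ ^ n) (truncate s f), truncate s f⟫_ℂ).re := by
    intro s f
    set v : EllTwo Γ := truncate s fun x => (‖f x‖ : ℂ) with hv
    have hnorm : ‖v‖ ^ 2 = ‖truncate s f‖ ^ 2 := by
      simp only [hv, norm_truncate_sq, Complex.norm_real, norm_norm]
    have habs : (⟪(markovOperator μ ^ n) v, v⟫_ℂ).re ≤
        ‖markovOperator μ‖ ^ n * ‖truncate s f‖ ^ 2 := by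
      rw [← hnorm]
      have hpow : ‖(markovOperator μ ^ n) v‖ ≤ ‖markovOperator μ‖ ^ n * ‖v‖ := by
        rcases n.eq_zero_or_pos with rfl | hn
        · simp
        · exact ((markovOperator μ ^ n).le_opNorm v).trans
            (mul_le_mul_of_nonneg_right (norm_pow_le' _ hn) (norm_nonneg v))
      calc (⟪(markovOperator μ ^ n) v, v⟫_ℂ).re ≤ ‖(markovOperator μ ^ n) v‖ * ‖v‖ :=
            (Complex.re_le_norm _).trans (norm_inner_le_norm _ _)
        _ ≤ ‖markovOperator μ‖ ^ n * ‖v‖ * ‖v‖ := by gcongr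
        _ = _ := by ring
    have hdiag : 2 * transProb μ n 1 1 * ‖truncate s f‖ ^ 2 ≤
        (⟪(markovOperator μ ^ n) (truncate s f), truncate s f⟫_ℂ).re +
          (⟪(markovOperator μ ^ n) v, v⟫_ℂ).re := by
      rw [hv, re_inner_pow_truncate, re_inner_pow_truncate, norm_truncate_sq, Finset.mul_sum,
        ← Finset.sum_add_distrib]
      refine Finset.sum_le_sum fun y hy => ?_
      rw [← Finset.sum_add_distrib]
      have hterm : ∀ x, transProb μ n x y * (⟪f y, f x⟫_ℂ).re +
          transProb μ n x y * (⟪(‖f y‖ : ℂ), (‖f x‖ : ℂ)⟫_ℂ).re =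
            transProb μ n x y * ((⟪f y, f x⟫_ℂ).re + ‖f y‖ * ‖f x‖) := fun x => by
        rw [mul_add]; congr 2; simp [mul_comm]
      simp only [hterm]
      -- All terms of the combined form are nonnegative by Cauchy–Schwarz; only the diagonal one is
      -- kept, where both forms contribute equally.
      refine le_trans (le_of_eq ?_) (Finset.single_le_sum (f := fun x =>
        transProb μ n x y * ((⟪f y, f x⟫_ℂ).re + ‖f y‖ * ‖f x‖)) (fun x _ => ?_) hy)
      · have : (⟪f y, f y⟫_ℂ).re = ‖f y‖ ^ 2 := (norm_sq_eq_re_inner (𝕜 := ℂ) (f y)).symm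
        simp only [this, transProb_self]
        ring
      · refine mul_nonneg (transProb_nonneg _ _ _ _) ?_
        have := (Complex.abs_re_le_norm _).trans (norm_inner_le_norm (𝕜 := ℂ) (f y) (f x))
        linarith [(abs_le.1 this).1]
    rw [sub_mul]
    linarith
  have hu := tendsto_truncate u
  exact le_of_tendsto_of_tendsto ((hu.norm.pow 2).const_mul _)
    ((Complex.continuous_re.tendsto _).comp
      ((((markovOperator μ ^ n).continuous.tendsto u).comp hu).inner hu))
    (Eventually.of_forall fun s => hfin s u)

/-- Each r below the radius gives p^n ≤ C r⁻ⁿ, hence ‖ℙ‖ ≤ r⁻¹; the other inequality is p^n ≤ ‖ℙ‖^n.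
-/
theorem greenRadius_eq (hsymm : IsSymmetric μ) (hirr : IsIrreducible μ) (x y : Γ) :
    greenRadius μ x y = ENNReal.ofReal ‖markovOperator μ‖⁻¹ := by
  have hpos := norm_markovOperator_pos μ
  have hcoeff : ∀ n, ‖FormalMultilinearSeries.ofScalars (𝕜 := ℂ) ℂ
      (fun n : ℕ => (transProb μ n x y : ℂ)) n‖ = transProb μ n x y := fun n => by
    rw [FormalMultilinearSeries.ofScalars_norm, Complex.norm_real,
      Real.norm_of_nonneg (transProb_nonneg μ n x y)]
  refine le_antisymm (ENNReal.le_of_forall_nnreal_lt fun r hr => ?_) ?_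
  · obtain ⟨C, -, hC⟩ := FormalMultilinearSeries.norm_mul_pow_le_of_lt_radius _ hr
    rcases eq_zero_or_pos r with rfl | hr0
    · simp
    have hr0' : (0 : ℝ) < r := hr0
    have hle := norm_markovOperator_le_of_transProb_le hsymm hirr (x := x) (y := y) (C := C)
      (inv_pos.2 hr0') fun n => by
        have := hC n
        rw [hcoeff] at this
        rwa [inv_pow, ← div_eq_mul_inv, le_div_iff₀ (by positivity)]
    rw [← ENNReal.ofReal_coe_nnreal]
    exact ENNReal.ofReal_le_ofReal ((le_inv_comm₀ hpos hr0').1 hle)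
  · refine FormalMultilinearSeries.le_radius_of_bound _ 1 (r := ‖markovOperator μ‖⁻¹.toNNReal)
      fun n => ?_
    rw [hcoeff, Real.coe_toNNReal _ (by positivity), inv_pow, ← div_eq_mul_inv,
      div_le_one (by positivity)]
    exact transProb_le_norm_pow n x y

theorem exists_spectrum_markovOperator_subset (hsymm : IsSymmetric μ) (haper : IsAperiodic μ) :
    ∃ ε : ℝ, 0 < ε ∧ spectrum ℂ (markovOperator μ) ⊆
      Complex.ofReal '' Set.Icc (-(‖markovOperator μ‖ * (1 + ε)⁻¹)) ‖markovOperator μ‖ := by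
  set ρ := ‖markovOperator μ‖ with hρ
  have hpos : 0 < ρ := norm_markovOperator_pos μ
  obtain ⟨n, hodd, hn⟩ := haper.exists_odd
  obtain ⟨ε, hε, hlt⟩ : ∃ ε : ℝ, 0 < ε ∧ ρ ^ n - 2 * transProb μ n 1 1 < (ρ * (1 + ε)⁻¹) ^ n := by
    -- At ε = 0 the inequality is strict because p^n(1, 1) > 0, so it persists for small ε > 0.
    have hcont : ContinuousAt (fun ε : ℝ => (ρ * (1 + ε)⁻¹) ^ n) 0 := by
      fun_prop (disch := norm_num)
    have hev : ∀ᶠ ε in 𝓝[>] (0 : ℝ), ρ ^ n - 2 * transProb μ n 1 1 < (ρ * (1 + ε)⁻¹) ^ n :=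
      nhdsWithin_le_nhds (hcont.eventually (lt_mem_nhds (by simpa using hn)))
    obtain ⟨ε, h1, h2⟩ := (hev.and self_mem_nhdsWithin).exists
    exact ⟨ε, h2, h1⟩
  refine ⟨ε, hε, fun l hl => ?_⟩
  have hreal : l = (l.re : ℂ) := hsymm.isSelfAdjoint_markovOperator.mem_spectrum_eq_re hl
  have hnorm : |l.re| ≤ ρ := by
    have : Nontrivial (EllTwo Γ →L[ℂ] EllTwo Γ) :=
      ⟨markovOperator μ, 0, norm_pos_iff.1 hpos⟩
    have : NormOneClass (EllTwo Γ →L[ℂ] EllTwo Γ) := inferInstance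
    exact (Complex.abs_re_le_norm l).trans (spectrum.norm_le_norm_of_mem hl)
  refine ⟨l.re, ⟨?_, (abs_le.1 hnorm).2⟩, hreal.symm⟩
  have hpow : 2 * transProb μ n 1 1 - ρ ^ n ≤ l.re ^ n := by
    refine le_of_mem_spectrum_of_le_inner (le_re_inner_pow n) ?_
    rw [Complex.ofReal_pow, ← hreal]
    exact spectrum.pow_mem_pow _ n hl
  refine hodd.strictMono_pow.le_iff_le.1 ?_
  rw [hodd.neg_pow]
  linarith

theorem hasSum_ringInverse_one_sub_smul [DecidableEq Γ] (x y : Γ) {z : ℂ}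
    (hz : ‖z‖ * ‖markovOperator μ‖ < 1) :
    HasSum (fun n : ℕ => (transProb μ n x y : ℂ) * z ^ n)
      (Ring.inverse (1 - z • markovOperator μ) (lp.single 2 y (1 : ℂ)) x) := by
  have h := hasSum_geom_series_inverse (z • markovOperator μ) ((norm_smul _ _).trans_lt hz)
  have hterm : ∀ n : ℕ, (transProb μ n x y : ℂ) * z ^ n =
      ((z • markovOperator μ) ^ n) (lp.single 2 y (1 : ℂ)) x := fun n => by
    rw [smul_pow, _root_.smul_apply, lp.coeFn_smul, Pi.smul_apply,
      markovOperator_pow_single, mul_one, smul_eq_mul, mul_comm]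
  simp only [hterm]
  exact hasSum_apply_apply h _ x

/-- For z ≠ 0, 1 - zℙ = z(z⁻¹ - ℙ) fails to be invertible only if z⁻¹ is in the spectrum; inversion
carries the nonzero points of the spectral interval into the two slits. -/
theorem isUnit_one_sub_smul {ε : ℝ} (h : spectrum ℂ (markovOperator μ) ⊆
      Complex.ofReal '' Set.Icc (-(‖markovOperator μ‖ * (1 + ε)⁻¹)) ‖markovOperator μ‖) {z : ℂ}
    (hz : z ∉ Complex.ofReal '' (Set.Iic (-(‖markovOperator μ‖⁻¹ * (1 + ε))) ∪
      Set.Ici ‖markovOperator μ‖⁻¹)) : IsUnit (1 - z • markovOperator μ) := by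
  have hpos := norm_markovOperator_pos μ
  rcases eq_or_ne z 0 with rfl | hz0
  · simp
  by_contra hunit
  have hmem : z⁻¹ ∈ spectrum ℂ (markovOperator μ) := by
    intro hu
    refine hunit ?_
    have : 1 - z • markovOperator μ =
        z • (algebraMap ℂ (EllTwo Γ →L[ℂ] EllTwo Γ) z⁻¹ - markovOperator μ) := by
      rw [smul_sub, Algebra.algebraMap_eq_smul_one, smul_smul, mul_inv_cancel₀ hz0, one_smul]
    rw [this]
    exact hu.smul (Units.mk0 z hz0)
  obtain ⟨t, ⟨ht1, ht2⟩, ht⟩ := h hmem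
  have hzt : ((t⁻¹ : ℝ) : ℂ) = z := by rw [Complex.ofReal_inv, ht, inv_inv]
  have ht0 : t ≠ 0 := by
    rintro rfl
    exact hz0 (by simpa using hzt.symm)
  refine hz ⟨t⁻¹, ?_, hzt⟩
  rcases ht0.lt_or_gt with hneg | hpos'
  · left
    have h1 : (-t)⁻¹ ≥ (‖markovOperator μ‖ * (1 + ε)⁻¹)⁻¹ :=
      inv_anti₀ (neg_pos.2 hneg) (by linarith)
    rw [mul_inv, inv_inv, inv_neg] at h1
    exact le_neg_of_le_neg h1
  · right
    exact inv_anti₀ hpos' ht2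

end MarkovOperator

end RandomWalk

theorem theorem8p3 {Γ : Type*} [Group Γ] [Countable Γ] (μ : PMF Γ)
    (hsymm : RandomWalk.IsSymmetric μ) (hirr : RandomWalk.IsIrreducible μ)
    (haper : RandomWalk.IsAperiodic μ) :
    ∃ R : ℝ, 0 < R ∧
      (∀ x y : Γ, RandomWalk.greenRadius μ x y = ENNReal.ofReal R) ∧
      ∃ ε : ℝ, 0 < ε ∧
        spectrum ℂ (RandomWalk.markovOperator μ) ⊆
          Complex.ofReal '' Set.Icc (-(R⁻¹ * (1 + ε)⁻¹)) R⁻¹ ∧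
        ∀ x y : Γ, ∃ F : ℂ → ℂ,
          DifferentiableOn ℂ F
            (Complex.ofReal '' (Set.Iic (-(R * (1 + ε))) ∪ Set.Ici R))ᶜ ∧
          ∀ z : ℂ, ‖z‖ < R →
            HasSum (fun n : ℕ => (RandomWalk.transProb μ n x y : ℂ) * z ^ n) (F z) := by
  classical
  have hpos := RandomWalk.norm_markovOperator_pos μ
  obtain ⟨ε, hε, hspec⟩ := RandomWalk.exists_spectrum_markovOperator_subset hsymm haper
  refine ⟨‖RandomWalk.markovOperator μ‖⁻¹, inv_pos.2 hpos, RandomWalk.greenRadius_eq hsymm hirr,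
    ε, hε, by rwa [inv_inv], fun x y =>
      -- The (x, y) entry of (1 - zℙ)⁻¹, whose Neumann series on |z| < R is the Green's function.
      ⟨fun z => Ring.inverse (1 - z • RandomWalk.markovOperator μ) (lp.single 2 y (1 : ℂ)) x,
        fun z hz => ?_, fun z hz => ?_⟩⟩
  · have hinv : DifferentiableAt ℂ
        (fun z : ℂ => Ring.inverse (1 - z • RandomWalk.markovOperator μ)) z :=
      DifferentiableAt.inverse (by fun_prop) (RandomWalk.isUnit_one_sub_smul hspec hz)
    exact ((((lp.evalCLM ℂ (fun _ : Γ => ℂ) 2 x).comp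
      (ContinuousLinearMap.apply ℂ (RandomWalk.EllTwo Γ) (lp.single 2 y (1 : ℂ)))).differentiableAt
        ).comp z hinv).differentiableWithinAt
  · exact RandomWalk.hasSum_ringInverse_one_sub_smul x y
      ((lt_inv_mul_iff₀' hpos).1 (by simpa using hz))
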